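/- Let $u,v\ge 0$ and let $e=(e_1,\dots,e_u)$ and $f=(f_1,\dots,f_v)$ be tuples of natural numbers, not all zero, such that the sets $\{e_1,\dots,e_u\}$ and $\{f_1,\dots,f_v\}$ are disjoint. For $n\in\mathbb N$ and $x\in\mathbb R$ set $$\mathcal Q_{e,f}(n)=\frac{\prod_{i=1}^u(e_in)!}{\prod_{j=1}^v(f_jn)!},\qquad F_{e,f}(x)=\sum_{n\ge 0}\mathcal Q_{e,f}(n)x^n\in\mathbb Q[[x]],\qquad \Delta_{e,f}(x)=\sum_{i=1}^u\lfloor e_ix\rfloor-\sum_{j=1}^v\lfloor f_jx\rfloor,$$ and $|e|=\sum_i e_i$, $|f|=\sum_j f_j$, $m_{e,f}=\big(\max\{e_1,\dots,e_u,f_1,\dots,f_v\}\big)^{-1}$. For a prime $p$, let $\mathbb Z_{(p)}$ be the ring of rational numbers whose denominator is not divisible by $p$. A sequence $(a(n))_{n\ge0}$ of rational numbers has the $p$-Lucas property if all $a(n)$ lie in $\mathbb Z_{(p)}$ and $a(w+mp)\equiv a(w)a(m) \bmod p\mathbb Z_{(p)}$ for all $w\in\{0,\dots,p-1\}$ and $m\in\mathbb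 N$. For a set $\mathcal S$ of prime numbers, let $\mathcal L_1(\mathcal S)$ be the set of all $g\in\mathbb Q[[x]]$ with constant term $1$ for which there is a constant $C$ such that, for every $p\in\mathcal S$, one has $g\in\mathbb Z_{(p)}[[x]]$ and there are an integer $k\ge1$ and a rational fraction $A\in\mathbb Q(x)\cap\mathbb Z_{(p)}[[x]]$ with $g(x)\equiv A(x)g(x^{p^k}) \bmod p\mathbb Z_{(p)}[[x]]$ and $H(A)\le Cp^k$, where the height $H(A)$ is the maximum of the degrees of the numerator and the denominator of $A$ in lowest terms. Let $\mathfrak L_1(\mathcal S)$ be the set of all $g\in\mathcal L_1(\mathcal S)$ for which there is an integer $k\ge1$, independent of $p$, such that for every $p\in\mathcal S$ the congruence $g(x)\equiv A(x)g(x^{p^k}) \bmod p\mathbb Z_{(p)}[[x]]$ holds for some polynomial $A\in\mathbb Z_{(p)}[x]$ of degree at most $p^k-1$. Then the following assertions are equivalent. (i) There exists an infinite set $\mathcal S$ of primes such that $F_{e,f}\in\mathfrak L_1(\mathcal S)$. (ii) The sequence $\mathcal Q_{e,f}$ is integer-valued and has the $p$-Lucas property for all primes $p$. (iii) $|e|=|f|$,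 and $\Delta_{e,f}(x)\ge 1$ for all real numbers $x$ with $m_{e,f}\le x<1$. -/

import Mathlib

namespace FactorialRatio

open scoped Nat

/-- `a` lies in `ℤ_(p)`, the set of rational numbers whose denominator is not divisible by `p`. -/
def IsPIntegral (p : ℕ) (a : ℚ) : Prop := ¬ p ∣ a.den

/-- `a ≡ b mod p ℤ_(p)`. -/
def CongrModP (p : ℕ) (a b : ℚ) : Prop := ∃ c : ℚ, IsPIntegral p c ∧ a - b = p * c

/-- `f ∈ ℤ_(p)[[x]]`. -/
def PIntegralSeries (p : ℕ) (f : PowerSeries ℚ) : Prop :=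
  ∀ n, IsPIntegral p (PowerSeries.coeff n f)

/-- `f ≡ g mod p ℤ_(p)[[x]]`. -/
def SeriesCongrModP (p : ℕ) (f g : PowerSeries ℚ) : Prop :=
  ∀ n, CongrModP p (PowerSeries.coeff n f) (PowerSeries.coeff n g)

/-- The power series `f(x^(p^k))`. -/
noncomputable def frobSubst (p : Nat.Primes) (k : ℕ) (f : PowerSeries ℚ) : PowerSeries ℚ :=
  PowerSeries.expand ((p : ℕ) ^ k) (pow_ne_zero k p.2.ne_zero) f

/-- The power series `B` is the expansion at the origin of the rational fraction `A`,
i.e. `A = B` holds in the field of Laurent series. -/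
def IsExpansion (A : RatFunc ℚ) (B : PowerSeries ℚ) : Prop :=
  (A.denom : PowerSeries ℚ) * B = (A.num : PowerSeries ℚ)

/-- The height of a rational fraction: the maximum of the degrees of numerator and denominator
in lowest terms. -/
noncomputable def height (A : RatFunc ℚ) : ℕ := max A.num.natDegree A.denom.natDegree

/-- The set `𝓛₁(ℤ, S)`. The requirement that the residue field at each `p ∈ S` be finite of
characteristic `p` is automatic, as this field is `ℤ/pℤ`. The constant `C` does not depend
on `p`. -/
def CalL (S : Set Nat.Primes) : Set (PowerSeries ℚ) :=
  {f | PowerSeries.constantCoeff f = 1 ∧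
    (∀ p ∈ S, PIntegralSeries p f) ∧
    ∃ C : ℝ, ∀ p ∈ S, ∃ k : ℕ, 0 < k ∧ ∃ (A : RatFunc ℚ) (B : PowerSeries ℚ),
      IsExpansion A B ∧ PIntegralSeries p B ∧
      SeriesCongrModP p f (B * frobSubst p k f) ∧
      (height A : ℝ) ≤ C * ((p : ℕ) : ℝ) ^ k}

/-- The set `𝔏₁(ℤ, S)`: those `f ∈ 𝓛₁(ℤ, S)` for which the congruence holds with an exponent `k`
independent of `p` and with a polynomial `A ∈ ℤ_(p)[x]` of degree at most `p^k - 1`. -/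
def FrakL (S : Set Nat.Primes) : Set (PowerSeries ℚ) :=
  {f | f ∈ CalL S ∧ ∃ k : ℕ, 0 < k ∧ ∀ p ∈ S, ∃ A : Polynomial ℚ,
      PIntegralSeries p (A : PowerSeries ℚ) ∧ A.natDegree ≤ (p : ℕ) ^ k - 1 ∧
      SeriesCongrModP p f ((A : PowerSeries ℚ) * frobSubst p k f)}

/-- The `p`-Lucas property of a sequence. -/
def HasLucasProperty (p : ℕ) (a : ℕ → ℚ) : Prop :=
  (∀ n, IsPIntegral p (a n)) ∧
    ∀ v < p, ∀ m : ℕ, CongrModP p (a (v + m * p)) (a v * a m)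

/-- The factorial ratio `Q_{e,f}(n) = ∏ (eᵢ n)! / ∏ (fⱼ n)!`. -/
def Q {u v : ℕ} (e : Fin u → ℕ) (f : Fin v → ℕ) (n : ℕ) : ℚ :=
  (∏ i, ((e i * n)! : ℚ)) / ∏ j, ((f j * n)! : ℚ)

/-- The generating series `F_{e,f}(x) = ∑ Q_{e,f}(n) x^n`. -/
def genSeries {u v : ℕ} (e : Fin u → ℕ) (f : Fin v → ℕ) : PowerSeries ℚ :=
  PowerSeries.mk (Q e f)

/-- Landau's function `Δ_{e,f}(x) = ∑ ⌊eᵢ x⌋ - ∑ ⌊fⱼ x⌋`. -/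
noncomputable def landau {u v : ℕ} (e : Fin u → ℕ) (f : Fin v → ℕ) (x : ℝ) : ℤ :=
  ∑ i, ⌊(e i : ℝ) * x⌋ - ∑ j, ⌊(f j : ℝ) * x⌋

/-- The largest of all the entries of `e` and `f`. -/
def maxEntry {u v : ℕ} (e : Fin u → ℕ) (f : Fin v → ℕ) : ℕ :=
  max (Finset.univ.sup e) (Finset.univ.sup f)

/-- `m_{e,f}`, the inverse of the largest entry. -/
noncomputable def mInv {u v : ℕ} (e : Fin u → ℕ) (f : Fin v → ℕ) : ℝ :=
  ((maxEntry e f : ℕ) : ℝ)⁻¹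

end FactorialRatio

/-! Everything rests on one identity. By Wilson's theorem, $(N+tp)!$ equals
$N!\,t!\,(-p)^t\binom{\lfloor N/p\rfloor+t}{t}$ up to a factor $\equiv 1 \bmod p$. When $|e|=|f|$
the powers of $-p$ cancel in the ratio, so $\mathcal Q(a+mp)=\mathcal Q(a)\mathcal Q(m)\,R\,c$ with
$c\equiv1$ and $R$ a quotient of products of binomials (`Q_add_mul_prime_of_sum_eq`).

(iii) ⇒ (ii): by Legendre's formula $v_p(\mathcal Q(n))=\sum_{k\ge1}\Delta(n/p^k)$, and $\Delta\ge0$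
by periodicity, whence integrality. For $a<p$, either every $\lfloor e_ia/p\rfloor$ and $\lfloor
f_ja/p\rfloor$ is zero and $R=1$, or $\Delta(a/p)\ge1$ and both sides of the Lucas congruence vanish
mod $p$.

(ii) ⇒ (i): truncating the series below degree $p$ gives $A$, with $k=1$.

(i) ⇒ (iii): comparing coefficients gives a Lucas congruence in base $p^k$. It forces $|e|=|f|$
(`sum_eq_of_congr`) and then descends to base $p$ (`lucas_of_congr_pow`). If $\Delta(x)\le0$ for
some $x\in[m_{e,f},1)$, take $a=\lceil xp\rceil$ with $p\in\mathcal S$ large: $\mathcal Q(a)$ is a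
$p$-adic unit and $R$ depends only on $x$ and $m$. Lucas forces $R\equiv1 \bmod p$ for large
$p\in\mathcal S$, contradicting `exists_prod_choose_ne`, where disjointness enters. -/

namespace FactorialRatio

open scoped Nat
open Finset

/-! ### Congruences modulo $p$ in terms of the $p$-adic norm. -/

section Norm

variable {p : ℕ} [hp : Fact p.Prime]

theorem isPIntegral_iff (a : ℚ) : IsPIntegral p a ↔ padicNorm p a ≤ 1 := by
  have hnorm : padicNorm p a = padicNorm p (a.num : ℚ) / padicNorm p (a.den : ℚ) := by
    rw [← padicNorm.div, Rat.num_div_den]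
  unfold IsPIntegral
  constructor
  · intro h
    rw [hnorm, (padicNorm.nat_eq_one_iff _).2 h, div_one]
    exact padicNorm.of_int _
  · intro h hd
    have hn : padicNorm p (a.num : ℚ) = 1 := by
      rw [padicNorm.int_eq_one_iff]
      intro hn
      exact Nat.not_coprime_of_dvd_of_dvd hp.out.one_lt (Int.natCast_dvd.1 hn) hd a.reduced
    have hlt := (padicNorm.nat_lt_one_iff (p := p) _).2 hd
    have hpos : 0 < padicNorm p (a.den : ℚ) :=
      (padicNorm.nonneg _).lt_of_ne' (padicNorm.nonzero (by exact_mod_cast a.den_nz))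
    rw [hnorm, hn, div_le_one hpos] at h
    exact absurd hlt (not_lt.2 h)

theorem padicNorm_lt_one_iff_le (a : ℚ) : padicNorm p a < 1 ↔ padicNorm p a ≤ (p : ℚ)⁻¹ := by
  have hp1 : (1 : ℚ) < p := by exact_mod_cast hp.out.one_lt
  refine ⟨fun h => ?_, fun h => h.trans_lt (inv_lt_one_of_one_lt₀ hp1)⟩
  by_cases ha : a = 0
  · subst ha
    simp
  obtain ⟨z, hz⟩ := padicNorm.values_discrete (p := p) ha
  rw [hz] at h ⊢
  rw [zpow_lt_one_iff_right₀ hp1] at h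
  rw [← zpow_neg_one]
  exact zpow_le_zpow_right₀ hp1.le (by omega)

theorem congrModP_iff (a b : ℚ) : CongrModP p a b ↔ padicNorm p (a - b) < 1 := by
  have hp0 : (0 : ℚ) < p := by exact_mod_cast hp.out.pos
  rw [padicNorm_lt_one_iff_le]
  constructor
  · rintro ⟨c, hc, h⟩
    rw [h, padicNorm.mul, padicNorm.padicNorm_p_of_prime]
    exact mul_le_of_le_one_right (by positivity) ((isPIntegral_iff c).1 hc)
  · intro h
    refine ⟨(a - b) / p, (isPIntegral_iff _).2 ?_, by field_simp⟩
    rw [padicNorm.div, padicNorm.padicNorm_p_of_prime]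
    exact div_le_one_of_le₀ h (by positivity)

theorem CongrModP.trans {a b c : ℚ} (h₁ : CongrModP p a b) (h₂ : CongrModP p b c) :
    CongrModP p a c := by
  rw [congrModP_iff] at *
  have := padicNorm.nonarchimedean (p := p) (q := a - b) (r := b - c)
  rw [sub_add_sub_cancel] at this
  exact this.trans_lt (max_lt h₁ h₂)

theorem CongrModP.symm {a b : ℚ} (h : CongrModP p a b) : CongrModP p b a := by
  rw [congrModP_iff] at *
  rwa [← padicNorm.neg, neg_sub]

theorem congrModP_of_norm_lt {a b : ℚ} (ha : padicNorm p a < 1) (hb : padicNorm p b < 1) :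
    CongrModP p a b :=
  (congrModP_iff a b).2 (padicNorm.sub.trans_lt (max_lt ha hb))

theorem CongrModP.norm_lt {a b : ℚ} (h : CongrModP p a b) (ha : padicNorm p a < 1) :
    padicNorm p b < 1 := by
  rw [congrModP_iff] at h
  have := padicNorm.sub (p := p) (q := a) (r := a - b)
  rw [sub_sub_cancel] at this
  exact this.trans_lt (max_lt ha h)

/-- `u` is congruent to `1` modulo `p`. -/
def OneUnit (p : ℕ) (u : ℚ) : Prop := padicNorm p (u - 1) < 1

theorem oneUnit_one {p : ℕ} : OneUnit p 1 := by simp [OneUnit]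

theorem OneUnit.norm_eq_one {u : ℚ} (h : OneUnit p u) : padicNorm p u = 1 := by
  have h1 := padicNorm.add_eq_max_of_ne (p := p) (q := u - 1) (r := 1)
    (by rw [padicNorm.one]; exact ne_of_lt h)
  rw [sub_add_cancel, padicNorm.one, max_eq_right (le_of_lt h)] at h1
  exact h1

theorem OneUnit.ne_zero {u : ℚ} (h : OneUnit p u) : u ≠ 0 := by
  rintro rfl
  simpa using h.norm_eq_one

theorem OneUnit.mul {u w : ℚ} (hu : OneUnit p u) (hw : OneUnit p w) : OneUnit p (u * w) := by
  have h : u * w - 1 = u * (w - 1) + (u - 1) := by ring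
  unfold OneUnit
  rw [h]
  refine padicNorm.nonarchimedean.trans_lt (max_lt ?_ hu)
  rw [padicNorm.mul, hu.norm_eq_one, one_mul]
  exact hw

theorem OneUnit.inv {u : ℚ} (hu : OneUnit p u) : OneUnit p u⁻¹ := by
  have h0 := hu.ne_zero
  have h : u⁻¹ - 1 = -((u - 1) / u) := by field_simp; ring
  unfold OneUnit
  rw [h, padicNorm.neg, padicNorm.div, hu.norm_eq_one, div_one]
  exact hu

theorem OneUnit.congrModP_mul {u a : ℚ} (hu : OneUnit p u) (ha : padicNorm p a ≤ 1) :
    CongrModP p (a * u) a := by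
  rw [congrModP_iff, show a * u - a = a * (u - 1) by ring, padicNorm.mul]
  exact (mul_le_of_le_one_left (padicNorm.nonneg _) ha).trans_lt hu

theorem oneUnit_of_congrModP {a u : ℚ} (ha : padicNorm p a = 1) (h : CongrModP p (a * u) a) :
    OneUnit p u := by
  rwa [congrModP_iff, show a * u - a = a * (u - 1) by ring, padicNorm.mul, ha, one_mul] at h

/-- A prime larger than the numerator cannot divide it. This turns "nonzero" into "nonzero mod $p$"
for large $p$. -/
theorem eventually_one_le_padicNorm {r : ℚ} (hr : r ≠ 0) :
    ∀ᶠ p : ℕ in Filter.atTop, p.Prime → 1 ≤ padicNorm p r := by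
  filter_upwards [Filter.eventually_gt_atTop r.num.natAbs] with p hlt hp
  have := Fact.mk hp
  have hn : padicNorm p (r.num : ℚ) = 1 := by
    rw [padicNorm.int_eq_one_iff]
    intro hd
    exact absurd (Nat.le_of_dvd (Int.natAbs_pos.2 (Rat.num_ne_zero.2 hr)) (Int.natCast_dvd.1 hd))
      (not_le.2 hlt)
  have hpos : 0 < padicNorm p (r.den : ℚ) :=
    (padicNorm.nonneg _).lt_of_ne' (padicNorm.nonzero (by exact_mod_cast r.den_nz))
  rw [← Rat.num_div_den r, padicNorm.div, hn, one_le_div hpos]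
  exact padicNorm.of_nat _

end Norm

/-! ### Factorials along arithmetic progressions of step $p$. -/

section Factorial

variable {p : ℕ} [hp : Fact p.Prime]

/-- Among $N+1,\dots,N+p$ exactly one is a multiple of $p$, namely $p(\lfloor N/p\rfloor+1)$; the
others have product $\equiv-1$. The induction starts from Wilson and multiplies by $(N+1+p)/(N+1)$,
which is $\equiv1$ unless $p\mid N+1$, when it is exactly the change in $\lfloor N/p\rfloor+1$. -/
theorem factorial_add_prime (N : ℕ) : ∃ u : ℚ, OneUnit p u ∧
    ((N + p)! : ℚ) = N ! * (-p) * (N / p + 1 : ℕ) * u := by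
  have hp0 : (p : ℚ) ≠ 0 := by exact_mod_cast hp.out.ne_zero
  induction N with
  | zero =>
    refine ⟨-((p - 1)! : ℚ), ?_, ?_⟩
    · unfold OneUnit
      have h : (-((p - 1)! : ℚ) - 1) = -(((p - 1)! + 1 : ℕ) : ℚ) := by push_cast; ring
      rw [h, padicNorm.neg, padicNorm.nat_lt_one_iff, ← ZMod.natCast_eq_zero_iff]
      push_cast
      rw [ZMod.wilsons_lemma]
      ring
    · have h := Nat.mul_factorial_pred hp.out.ne_zero
      rw [zero_add, ← h]
      simp
  | succ N ih =>
    obtain ⟨u, hu, h⟩ := ih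
    have hN : ((N : ℚ) + 1) ≠ 0 := by positivity
    have e1 : ((N + 1 + p)! : ℚ) = (N + 1 + p) * (N + p)! := by
      rw [show N + 1 + p = (N + p) + 1 by ring, Nat.factorial_succ]
      push_cast
      ring
    by_cases hd : p ∣ N + 1
    · obtain ⟨c, hc⟩ := hd
      have hc0 : c ≠ 0 := by rintro rfl; omega
      have hq : (N + 1) / p = N / p + 1 := by
        rw [Nat.succ_div_of_dvd ⟨c, hc⟩]
      have hq' : (N + 1) / p = c := by rw [hc, Nat.mul_div_cancel_left _ hp.out.pos]
      refine ⟨u, hu, ?_⟩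
      rw [e1, h, ← hq, hq', Nat.factorial_succ]
      have hc' : (N : ℚ) + 1 = p * c := by exact_mod_cast hc
      push_cast
      rw [hc']
      ring
    · have hq : (N + 1) / p = N / p := Nat.succ_div_of_not_dvd hd
      refine ⟨u * ((N + 1 + p) / (N + 1)), hu.mul ?_, ?_⟩
      · unfold OneUnit
        have h1 : ((N : ℚ) + 1 + p) / (N + 1) - 1 = p / ((N + 1 : ℕ) : ℚ) := by
          push_cast
          field_simp
          ring
        rw [h1, padicNorm.div, (padicNorm.nat_eq_one_iff _).2 hd, div_one]
        exact padicNorm.padicNorm_p_lt_one_of_prime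
      · rw [e1, h, hq, Nat.factorial_succ]
        push_cast
        field_simp

theorem factorial_add_mul_prime (N t : ℕ) : ∃ u : ℚ, OneUnit p u ∧
    ((N + t * p)! : ℚ) = N ! * t ! * (-p) ^ t * ((N / p + t).choose t : ℕ) * u := by
  suffices h : ∃ u : ℚ, OneUnit p u ∧
      ((N + t * p)! : ℚ) = N ! * (-p) ^ t * ((N / p + 1).ascFactorial t : ℕ) * u by
    obtain ⟨u, hu, h⟩ := h
    refine ⟨u, hu, ?_⟩
    rw [h, Nat.ascFactorial_eq_factorial_mul_choose]
    push_cast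
    ring
  induction t with
  | zero => exact ⟨1, oneUnit_one, by simp⟩
  | succ t ih =>
    obtain ⟨u, hu, h⟩ := ih
    obtain ⟨w, hw, h'⟩ := factorial_add_prime (p := p) (N + t * p)
    refine ⟨u * w, hu.mul hw, ?_⟩
    rw [show N + (t + 1) * p = N + t * p + p by ring, h', h,
      Nat.add_mul_div_right _ _ hp.out.pos, Nat.ascFactorial_succ]
    push_cast
    ring

theorem prod_factorial_add_mul_prime {w : ℕ} (g : Fin w → ℕ) (a m : ℕ) : ∃ u : ℚ, OneUnit p u ∧
    ∏ i, ((g i * (a + m * p))! : ℚ) = (∏ i, ((g i * a)! : ℚ)) * (∏ i, ((g i * m)! : ℚ)) *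
      (-p) ^ ((∑ i, g i) * m) * (∏ i, (((g i * a / p + g i * m).choose (g i * m) : ℕ) : ℚ)) * u := by
  choose u hu h using fun i => factorial_add_mul_prime (p := p) (g i * a) (g i * m)
  refine ⟨∏ i, u i, Finset.prod_induction _ (OneUnit p) (fun _ _ => OneUnit.mul) oneUnit_one
    (fun i _ => hu i), ?_⟩
  rw [Finset.sum_mul, ← Finset.prod_pow_eq_pow_sum]
  simp only [← Finset.prod_mul_distrib]
  refine Finset.prod_congr rfl fun i _ => ?_
  rw [← h i]
  congr 3
  ring

end Factorial

/-! ### The multiplicative identity for $\mathcal Q(a+mp)$. -/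

section Ratio

variable {u v : ℕ} (e : Fin u → ℕ) (f : Fin v → ℕ)

theorem Q_ne_zero (n : ℕ) : Q e f n ≠ 0 :=
  div_ne_zero (Finset.prod_ne_zero_iff.2 fun i _ => by exact_mod_cast Nat.factorial_ne_zero _)
    (Finset.prod_ne_zero_iff.2 fun i _ => by exact_mod_cast Nat.factorial_ne_zero _)

theorem Q_zero : Q e f 0 = 1 := by simp [Q]

theorem Q_add_mul_prime {p : ℕ} [Fact p.Prime] (a m : ℕ) : ∃ c : ℚ, OneUnit p c ∧
    Q e f (a + m * p) * (-p) ^ ((∑ j, f j) * m) = Q e f a * Q e f m * (-p) ^ ((∑ i, e i) * m) *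
      ((∏ i, (((e i * a / p + e i * m).choose (e i * m) : ℕ) : ℚ)) /
        ∏ j, (((f j * a / p + f j * m).choose (f j * m) : ℕ) : ℚ)) * c := by
  obtain ⟨c, hc, h⟩ := prod_factorial_add_mul_prime (p := p) e a m
  obtain ⟨d, hd, h'⟩ := prod_factorial_add_mul_prime (p := p) f a m
  refine ⟨c * d⁻¹, hc.mul hd.inv, ?_⟩
  have hp0 : (-p : ℚ) ≠ 0 := neg_ne_zero.2 (by exact_mod_cast (Fact.out : p.Prime).ne_zero)
  have h1 : ∀ n, ∏ j, ((f j * n)! : ℚ) ≠ 0 := fun n =>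
    Finset.prod_ne_zero_iff.2 fun i _ => by exact_mod_cast Nat.factorial_ne_zero _
  have h2 : ∏ j, (((f j * a / p + f j * m).choose (f j * m) : ℕ) : ℚ) ≠ 0 :=
    Finset.prod_ne_zero_iff.2 fun i _ => by
      exact_mod_cast (Nat.choose_pos (Nat.le_add_left _ _)).ne'
  have h3 := hd.ne_zero
  have h4 := h1 a
  have h5 := h1 m
  have h6 := pow_ne_zero ((∑ j, f j) * m) hp0
  unfold Q
  rw [h, h']
  generalize (-p : ℚ) ^ ((∑ j, f j) * m) = X at *
  field_simp

theorem Q_mul_prime {p : ℕ} [Fact p.Prime] (m : ℕ) : ∃ c : ℚ, OneUnit p c ∧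
    Q e f (m * p) * (-p) ^ ((∑ j, f j) * m) = Q e f m * (-p) ^ ((∑ i, e i) * m) * c := by
  obtain ⟨c, hc, h⟩ := Q_add_mul_prime e f (p := p) 0 m
  refine ⟨c, hc, ?_⟩
  simpa [Q_zero] using h

variable {e f}

theorem Q_add_mul_prime_of_sum_eq (hs : ∑ i, e i = ∑ j, f j) {p : ℕ} [Fact p.Prime] (a m : ℕ) :
    ∃ c : ℚ, OneUnit p c ∧ Q e f (a + m * p) = Q e f a * Q e f m *
      ((∏ i, (((e i * a / p + e i * m).choose (e i * m) : ℕ) : ℚ)) /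
        ∏ j, (((f j * a / p + f j * m).choose (f j * m) : ℕ) : ℚ)) * c := by
  obtain ⟨c, hc, h⟩ := Q_add_mul_prime e f (p := p) a m
  have hp0 : (-p : ℚ) ≠ 0 := neg_ne_zero.2 (by exact_mod_cast (Fact.out : p.Prime).ne_zero)
  refine ⟨c, hc, mul_right_cancel₀ (pow_ne_zero ((∑ j, f j) * m) hp0) ?_⟩
  rw [h, hs]
  ring

theorem Q_mul_prime_pow_of_sum_eq (hs : ∑ i, e i = ∑ j, f j) {p : ℕ} [Fact p.Prime] (n k : ℕ) :
    ∃ c : ℚ, OneUnit p c ∧ Q e f (n * p ^ k) = Q e f n * c := by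
  induction k with
  | zero => exact ⟨1, oneUnit_one, by simp⟩
  | succ k ih =>
    obtain ⟨c, hc, h⟩ := ih
    obtain ⟨d, hd, h'⟩ := Q_mul_prime e f (p := p) (n * p ^ k)
    have hp0 : (-p : ℚ) ≠ 0 := neg_ne_zero.2 (by exact_mod_cast (Fact.out : p.Prime).ne_zero)
    refine ⟨c * d, hc.mul hd,
      mul_right_cancel₀ (pow_ne_zero ((∑ j, f j) * (n * p ^ k)) hp0) ?_⟩
    rw [pow_succ, ← mul_assoc, h', h, hs]
    ring

end Ratio

/-! ### Landau's function, Legendre's formula, and (iii) ⇒ (ii). -/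

section Landau

variable {u v : ℕ} {e : Fin u → ℕ} {f : Fin v → ℕ}

theorem le_maxEntry_left (e : Fin u → ℕ) (f : Fin v → ℕ) (i : Fin u) : e i ≤ maxEntry e f :=
  (Finset.le_sup (f := e) (Finset.mem_univ i)).trans (le_max_left _ _)

theorem le_maxEntry_right (e : Fin u → ℕ) (f : Fin v → ℕ) (j : Fin v) : f j ≤ maxEntry e f :=
  (Finset.le_sup (f := f) (Finset.mem_univ j)).trans (le_max_right _ _)

theorem floor_mul_div (a n d : ℕ) : ⌊(a : ℝ) * ((n : ℝ) / d)⌋ = ((a * n / d : ℕ) : ℤ) := by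
  rw [← mul_div_assoc, ← Nat.cast_mul, Int.floor_div_natCast, Int.floor_natCast]
  norm_cast

theorem landau_div (n d : ℕ) : landau e f ((n : ℝ) / d) =
    ∑ i, ((e i * n / d : ℕ) : ℤ) - ∑ j, ((f j * n / d : ℕ) : ℤ) := by
  simp only [landau, floor_mul_div]

theorem landau_eq_zero_of_lt {x : ℝ} (hx : 0 ≤ x) (h : (maxEntry e f : ℝ) * x < 1) :
    landau e f x = 0 := by
  have key : ∀ a : ℕ, a ≤ maxEntry e f → ⌊(a : ℝ) * x⌋ = 0 := by
    intro a ha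
    rw [Int.floor_eq_zero_iff]
    exact ⟨by positivity, lt_of_le_of_lt (by gcongr) h⟩
  unfold landau
  rw [Finset.sum_eq_zero fun i _ => key _ (le_maxEntry_left e f i),
    Finset.sum_eq_zero fun j _ => key _ (le_maxEntry_right e f j), sub_zero]

/-- Removing $\lfloor x\rfloor$ changes $\Delta$ by $(|e|-|f|)\lfloor x\rfloor=0$. -/
theorem landau_fract (hs : ∑ i, e i = ∑ j, f j) (x : ℝ) :
    landau e f (Int.fract x) = landau e f x := by
  have key : ∀ a : ℕ, ⌊(a : ℝ) * Int.fract x⌋ = ⌊(a : ℝ) * x⌋ - a * ⌊x⌋ := by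
    intro a
    rw [← Int.self_sub_floor, mul_sub, ← Int.floor_sub_intCast]
    push_cast
    rfl
  simp only [landau, key, Finset.sum_sub_distrib, ← Finset.sum_mul]
  have hs' : ∑ i, (e i : ℤ) = ∑ j, (f j : ℤ) := by exact_mod_cast hs
  rw [hs']
  ring

theorem landau_nonneg (hpos : 0 < maxEntry e f) (hs : ∑ i, e i = ∑ j, f j)
    (h : ∀ x : ℝ, mInv e f ≤ x → x < 1 → 1 ≤ landau e f x) (x : ℝ) : 0 ≤ landau e f x := by
  rw [← landau_fract hs]
  rcases lt_or_ge (Int.fract x) (mInv e f) with hlt | hge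
  · refine (landau_eq_zero_of_lt (Int.fract_nonneg x) ?_).ge
    have hM : (0 : ℝ) < maxEntry e f := by exact_mod_cast hpos
    rwa [mInv, ← one_div, lt_div_iff₀' hM] at hlt
  · exact zero_le_one.trans (h _ hge (Int.fract_lt_one x))

theorem padicValRat_prod_factorial {p w : ℕ} [Fact p.Prime] (g : Fin w → ℕ) {n b : ℕ}
    (h : ∀ i, g i * n < p ^ b) : padicValRat p (∏ i, ((g i * n)! : ℚ)) =
      ∑ k ∈ Finset.Ico 1 b, ∑ i, ((g i * n / p ^ k : ℕ) : ℤ) := by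
  rw [Finset.sum_comm]
  have key : ∀ s : Finset (Fin w), padicValRat p (∏ i ∈ s, ((g i * n)! : ℚ)) =
      ∑ i ∈ s, padicValRat p ((g i * n)! : ℚ) := by
    intro s
    induction s using Finset.cons_induction with
    | empty => simp
    | cons i s hi ih =>
      rw [Finset.prod_cons, Finset.sum_cons, padicValRat.mul
        (by exact_mod_cast Nat.factorial_ne_zero _)
        (Finset.prod_ne_zero_iff.2 fun i _ => by exact_mod_cast Nat.factorial_ne_zero _), ih]
  rw [key]
  refine Finset.sum_congr rfl fun i _ => ?_
  rw [padicValRat.of_nat]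
  rcases Nat.eq_zero_or_pos (g i * n) with h0 | h0
  · simp [h0]
  rw [padicValNat_factorial (Nat.log_lt_of_lt_pow h0.ne' (h i))]
  push_cast
  rfl

theorem padicValRat_Q {p : ℕ} [Fact p.Prime] {n b : ℕ} (h : maxEntry e f * n < p ^ b) :
    padicValRat p (Q e f n) = ∑ k ∈ Finset.Ico 1 b, landau e f ((n : ℝ) / (p ^ k : ℕ)) := by
  have he : ∀ i, e i * n < p ^ b := fun i =>
    (Nat.mul_le_mul_right n (le_maxEntry_left e f i)).trans_lt h
  have hf : ∀ i, f i * n < p ^ b := fun i =>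
    (Nat.mul_le_mul_right n (le_maxEntry_right e f i)).trans_lt h
  have h1 : ∀ {w : ℕ} (g : Fin w → ℕ), ∏ j, ((g j * n)! : ℚ) ≠ 0 := fun g =>
    Finset.prod_ne_zero_iff.2 fun i _ => by exact_mod_cast Nat.factorial_ne_zero _
  unfold Q
  rw [padicValRat.div (h1 e) (h1 f), padicValRat_prod_factorial e he,
    padicValRat_prod_factorial f hf, ← Finset.sum_sub_distrib]
  simp only [landau_div]

theorem padicNorm_Q (p : ℕ) (n : ℕ) :
    padicNorm p (Q e f n) = (p : ℚ) ^ (-padicValRat p (Q e f n)) :=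
  padicNorm.eq_zpow_of_nonzero (Q_ne_zero e f n)

theorem padicNorm_Q_le_one {p : ℕ} [hp : Fact p.Prime] (h : ∀ x, 0 ≤ landau e f x) (n : ℕ) :
    padicNorm p (Q e f n) ≤ 1 := by
  rw [padicNorm_Q, padicValRat_Q (Nat.lt_pow_self hp.out.one_lt)]
  exact zpow_le_one_of_nonpos₀ (by exact_mod_cast hp.out.one_lt.le)
    (neg_nonpos.2 (Finset.sum_nonneg fun _ _ => h _))

theorem padicNorm_Q_lt_one {p : ℕ} [hp : Fact p.Prime] (h : ∀ x, 0 ≤ landau e f x) {n : ℕ}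
    (hn : 1 ≤ landau e f ((n : ℝ) / p)) : padicNorm p (Q e f n) < 1 := by
  -- The `+ 2` guarantees that the index $k=1$ lies in the range of Legendre's sum.
  have hb : maxEntry e f * n < p ^ (maxEntry e f * n + 2) :=
    (Nat.lt_pow_self hp.out.one_lt).trans (Nat.pow_lt_pow_right hp.out.one_lt (by omega))
  rw [padicNorm_Q, padicValRat_Q hb, zpow_lt_one_iff_right₀ (by exact_mod_cast hp.out.one_lt),
    neg_lt_zero]
  refine Finset.sum_pos' (fun _ _ => h _) ⟨1, by simp, ?_⟩
  rw [pow_one]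
  omega

/-- All factorials are of numbers below $p^2$, so only the $k=1$ term of Legendre's sum survives. -/
theorem padicNorm_Q_of_lt {p : ℕ} [hp : Fact p.Prime] {a : ℕ} (ha : a < p)
    (hM : maxEntry e f ≤ p) :
    padicNorm p (Q e f a) = (p : ℚ) ^ (-landau e f ((a : ℝ) / p)) := by
  have hb : maxEntry e f * a < p ^ 2 := by
    have := hp.out.pos
    nlinarith
  rw [padicNorm_Q, padicValRat_Q hb]
  simp

theorem exists_int_Q (h : ∀ x, 0 ≤ landau e f x) (n : ℕ) : ∃ z : ℤ, Q e f n = z := by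
  refine ⟨(Q e f n).num, ((Rat.den_eq_one_iff _).1 ?_).symm⟩
  by_contra hd
  obtain ⟨p, hp, hpd⟩ := Nat.exists_prime_and_dvd hd
  have := Fact.mk hp
  exact (isPIntegral_iff _).2 (padicNorm_Q_le_one (p := p) h n) hpd

theorem hasLucasProperty_of_landau (hpos : 0 < maxEntry e f) (hs : ∑ i, e i = ∑ j, f j)
    (h : ∀ x : ℝ, mInv e f ≤ x → x < 1 → 1 ≤ landau e f x) {p : ℕ} (hp : p.Prime) :
    HasLucasProperty p (Q e f) := by
  have := Fact.mk hp
  have h0 := landau_nonneg hpos hs h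
  refine ⟨fun n => (isPIntegral_iff _).2 (padicNorm_Q_le_one h0 n), fun a ha m => ?_⟩
  have hp0 : (0 : ℝ) < p := by exact_mod_cast hp.pos
  rcases lt_or_ge (maxEntry e f * a) p with hlt | hge
  · obtain ⟨c, hc, hQ⟩ := Q_add_mul_prime_of_sum_eq hs (p := p) a m
    have he : ∀ i, e i * a / p = 0 := fun i =>
      Nat.div_eq_of_lt ((Nat.mul_le_mul_right a (le_maxEntry_left e f i)).trans_lt hlt)
    have hf : ∀ i, f i * a / p = 0 := fun i =>
      Nat.div_eq_of_lt ((Nat.mul_le_mul_right a (le_maxEntry_right e f i)).trans_lt hlt)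
    simp only [he, hf, zero_add, Nat.choose_self, Nat.cast_one, Finset.prod_const_one, div_one,
      mul_one] at hQ
    rw [hQ]
    refine hc.congrModP_mul ?_
    rw [padicNorm.mul]
    exact mul_le_one₀ (padicNorm_Q_le_one h0 a) (padicNorm.nonneg _) (padicNorm_Q_le_one h0 m)
  · have hge' : mInv e f ≤ (a : ℝ) / p := by
      have hM : (0 : ℝ) < maxEntry e f := by exact_mod_cast hpos
      rw [mInv, inv_le_iff_one_le_mul₀' hM, ← mul_div_assoc, one_le_div hp0]
      exact_mod_cast hge
    have hΔ := h _ hge' ((div_lt_one hp0).2 (by exact_mod_cast ha))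
    -- Both sides vanish mod $p$: $(a+mp)/p$ and $a/p$ differ by an integer, so $\Delta\ge1$ at
    -- each.
    refine congrModP_of_norm_lt (padicNorm_Q_lt_one h0 ?_) ?_
    · rw [← landau_fract hs]
      have : ((a + m * p : ℕ) : ℝ) / p = a / p + (m : ℕ) := by
        push_cast
        field_simp
      rwa [this, Int.fract_add_natCast, landau_fract hs]
    · rw [padicNorm.mul]
      exact mul_lt_one_of_nonneg_of_lt_one_left (padicNorm.nonneg _)
        (padicNorm_Q_lt_one h0 hΔ) (padicNorm_Q_le_one h0 m)

end Landau

/-! ### Functional congruences for series versus Lucas congruences for coefficients. -/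

section Series

/-- As $\deg A<p^k$, uniqueness of Euclidean division by $p^k$ leaves a single term in the
convolution. -/
theorem coeff_mul_frobSubst (p : Nat.Primes) (k : ℕ) (A : Polynomial ℚ) (g : PowerSeries ℚ)
    (hA : A.natDegree < (p : ℕ) ^ k) {a : ℕ} (ha : a < (p : ℕ) ^ k) (m : ℕ) :
    PowerSeries.coeff (a + m * (p : ℕ) ^ k) ((A : PowerSeries ℚ) * frobSubst p k g) =
      A.coeff a * PowerSeries.coeff m g := by
  rw [PowerSeries.coeff_mul, Finset.sum_eq_single (a, m * (p : ℕ) ^ k)]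
  · rw [frobSubst, mul_comm m, PowerSeries.coeff_expand_mul, Polynomial.coeff_coe]
  · rintro ⟨i, j⟩ hij hne
    rw [Finset.HasAntidiagonal.mem_antidiagonal] at hij
    rw [Polynomial.coeff_coe]
    rcases lt_or_ge i ((p : ℕ) ^ k) with hi | hi
    · by_cases hd : (p : ℕ) ^ k ∣ j
      · obtain ⟨t, rfl⟩ := hd
        exfalso
        apply hne
        have h1 := congrArg (· % (p : ℕ) ^ k) hij
        simp only [Nat.add_mul_mod_self_left, Nat.add_mul_mod_self_right, Nat.mod_eq_of_lt hi,
          Nat.mod_eq_of_lt ha] at h1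
        subst h1
        simpa using hij
      · rw [frobSubst, PowerSeries.coeff_expand_of_not_dvd _ _ _ hd, mul_zero]
    · rw [Polynomial.coeff_eq_zero_of_natDegree_lt (hA.trans_le hi), zero_mul]
  · intro h
    simp at h

theorem isExpansion_coe (A : Polynomial ℚ) :
    IsExpansion (algebraMap (Polynomial ℚ) (RatFunc ℚ) A) (A : PowerSeries ℚ) := by
  simp [IsExpansion, RatFunc.num_algebraMap, RatFunc.denom_algebraMap]

theorem height_algebraMap (A : Polynomial ℚ) :
    height (algebraMap (Polynomial ℚ) (RatFunc ℚ) A) = A.natDegree := by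
  simp [height, RatFunc.num_algebraMap, RatFunc.denom_algebraMap]

theorem mk_mem_FrakL {a : ℕ → ℚ} (h0 : a 0 = 1) {S : Set Nat.Primes}
    (h : ∀ p ∈ S, HasLucasProperty p a) : PowerSeries.mk a ∈ FrakL S := by
  have key : ∀ p ∈ S, ∃ A : Polynomial ℚ, PIntegralSeries p (A : PowerSeries ℚ) ∧
      A.natDegree ≤ (p : ℕ) ^ 1 - 1 ∧
      SeriesCongrModP p (PowerSeries.mk a) ((A : PowerSeries ℚ) * frobSubst p 1 (.mk a)) := by
    intro p hp
    have hp0 : 0 < (p : ℕ) := p.2.pos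
    obtain ⟨hint, hluc⟩ := h p hp
    set A : Polynomial ℚ := ∑ i ∈ Finset.range p, Polynomial.monomial i (a i) with hA
    have hco : ∀ n, A.coeff n = if n < (p : ℕ) then a n else 0 := by
      intro n
      simp [hA, Polynomial.finsetSum_coeff, Polynomial.coeff_monomial]
    have hdeg : A.natDegree ≤ (p : ℕ) - 1 := by
      rw [Polynomial.natDegree_le_iff_coeff_eq_zero]
      intro n hn
      rw [hco, if_neg (by omega)]
    refine ⟨A, fun n => ?_, by rwa [pow_one], fun n => ?_⟩
    · rw [Polynomial.coeff_coe, hco]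
      split_ifs
      · exact hint n
      · simpa [IsPIntegral] using p.2.one_lt.ne'
    · have hlt := Nat.mod_lt n hp0
      have hn : n = n % p + n / p * (p : ℕ) ^ 1 := by
        rw [pow_one, mul_comm]
        exact (Nat.mod_add_div n p).symm
      rw [hn, coeff_mul_frobSubst p 1 A _ (by rw [pow_one]; omega) (by rwa [pow_one]), ← hn, hco,
        if_pos hlt, PowerSeries.coeff_mk, PowerSeries.coeff_mk]
      have := hluc _ hlt (n / p)
      rw [pow_one] at hn
      rwa [← hn] at this
  refine ⟨⟨by simpa using h0, fun p hp n => ?_, 1, fun p hp => ⟨1, one_pos, ?_⟩⟩, 1, one_pos, key⟩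
  · rw [PowerSeries.coeff_mk]
    exact (h p hp).1 n
  · obtain ⟨A, h1, h2, h3⟩ := key p hp
    refine ⟨_, _, isExpansion_coe A, h1, h3, ?_⟩
    rw [height_algebraMap, one_mul]
    exact_mod_cast h2.trans (Nat.sub_le _ _)

theorem congr_of_mem_FrakL {a : ℕ → ℚ} (h0 : a 0 = 1) {S : Set Nat.Primes}
    (h : PowerSeries.mk a ∈ FrakL S) : (∀ p ∈ S, ∀ n, IsPIntegral p (a n)) ∧
    ∃ k : ℕ, 0 < k ∧ ∀ p ∈ S, ∀ b < (p : ℕ) ^ k, ∀ m,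
      CongrModP p (a (b + m * (p : ℕ) ^ k)) (a b * a m) := by
  obtain ⟨⟨-, hint, -⟩, k, hk, hcong⟩ := h
  have hint' : ∀ p ∈ S, ∀ n, IsPIntegral p (a n) := fun p hp n => by
    simpa using hint p hp n
  refine ⟨hint', k, hk, fun p hp b hb m => ?_⟩
  have := Fact.mk p.2
  obtain ⟨A, -, hdeg, hA⟩ := hcong p hp
  have hpk : 0 < (p : ℕ) ^ k := pow_pos p.2.pos k
  have hdeg' : A.natDegree < (p : ℕ) ^ k := by omega
  have h1 : ∀ m, CongrModP p (a (b + m * (p : ℕ) ^ k)) (A.coeff b * a m) := fun m => by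
    have := hA (b + m * (p : ℕ) ^ k)
    rwa [coeff_mul_frobSubst p k A _ hdeg' hb, PowerSeries.coeff_mk, PowerSeries.coeff_mk] at this
  refine (h1 m).trans ?_
  -- Taking $m=0$ identifies the unknown coefficient of $A$ with $a(b)$ mod $p$.
  have h2 := h1 0
  rw [zero_mul, add_zero, h0, mul_one] at h2
  have h3 := h2.symm
  rw [congrModP_iff] at h3 ⊢
  rw [← sub_mul, padicNorm.mul]
  exact mul_lt_one_of_nonneg_of_lt_one_left (padicNorm.nonneg _) h3
    ((isPIntegral_iff _).1 (hint' p hp m))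

end Series

/-! ### The binomial quotient is not identically $1$. -/

section Choose

/-- The polynomial `∏ᵢ ∏_{1 ≤ s ≤ qᵢ} (gᵢ X + s)`. -/
noncomputable def risingPoly {w : ℕ} (g q : Fin w → ℕ) : Polynomial ℚ :=
  ∏ i, ∏ s ∈ Finset.range (q i), (Polynomial.C (g i : ℚ) * Polynomial.X + Polynomial.C (s + 1 : ℚ))

theorem eval_risingPoly {w : ℕ} (g q : Fin w → ℕ) (x : ℚ) :
    (risingPoly g q).eval x = ∏ i, ∏ s ∈ Finset.range (q i), ((g i : ℚ) * x + (s + 1)) := by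
  simp [risingPoly, Polynomial.eval_prod]

theorem eval_natCast_risingPoly {w : ℕ} (g q : Fin w → ℕ) (m : ℕ) :
    (risingPoly g q).eval (m : ℚ) =
      (∏ i, ((q i)! : ℚ)) * ∏ i, (((q i + g i * m).choose (g i * m) : ℕ) : ℚ) := by
  rw [eval_risingPoly, ← Finset.prod_mul_distrib]
  refine Finset.prod_congr rfl fun i _ => ?_
  have h : ((q i)! : ℚ) * ((g i * m + q i).choose (q i) : ℕ) =
      ((g i * m + 1).ascFactorial (q i) : ℕ) := by
    rw [Nat.ascFactorial_eq_factorial_mul_choose, Nat.cast_mul]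
  rw [← Nat.choose_symm_add, add_comm (q i), h, Nat.ascFactorial_eq_prod_range]
  push_cast
  exact Finset.prod_congr rfl fun s _ => by ring

/-- A factor $g_iX+s$ with $s\ge1$ vanishes at $-1/M$ only if $g_i=sM$, and $g_i\le M$ then forces
$s=1$. Positivity of $q_i$ ensures that the factor $s=1$ is present. -/
theorem eval_risingPoly_eq_zero_iff {w : ℕ} {g q : Fin w → ℕ} {M : ℕ} (hM : 0 < M)
    (hg : ∀ i, g i ≤ M) (hq : ∀ i, g i = M → 0 < q i) :
    (risingPoly g q).eval (-(M : ℚ)⁻¹) = 0 ↔ ∃ i, g i = M := by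
  have hM' : (M : ℚ) ≠ 0 := by exact_mod_cast hM.ne'
  rw [eval_risingPoly]
  constructor
  · intro h
    obtain ⟨i, -, hi⟩ := Finset.prod_eq_zero_iff.1 h
    obtain ⟨s, -, hs⟩ := Finset.prod_eq_zero_iff.1 hi
    refine ⟨i, le_antisymm (hg i) ?_⟩
    have h1 : (g i : ℚ) = (s + 1) * M := by
      field_simp at hs
      linarith
    have h2 : g i = (s + 1) * M := by exact_mod_cast h1
    rw [h2]
    exact Nat.le_mul_of_pos_left M s.succ_pos
  · rintro ⟨i, hi⟩
    refine Finset.prod_eq_zero (Finset.mem_univ i)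
      (Finset.prod_eq_zero (Finset.mem_range.2 (hq i hi)) ?_)
    rw [hi]
    field_simp
    simp

theorem exists_maxEntry {u v : ℕ} (e : Fin u → ℕ) (f : Fin v → ℕ) (hpos : 0 < maxEntry e f) :
    (∃ i, e i = maxEntry e f) ∨ ∃ j, f j = maxEntry e f := by
  have key : ∀ {w : ℕ} (g : Fin w → ℕ), 0 < Finset.univ.sup g → ∃ i, g i = Finset.univ.sup g := by
    intro w g h
    have hne : (Finset.univ : Finset (Fin w)).Nonempty := by
      by_contra hne
      rw [Finset.not_nonempty_iff_eq_empty] at hne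
      simp [hne] at h
    obtain ⟨i, -, hi⟩ := Finset.exists_mem_eq_sup _ hne g
    exact ⟨i, hi.symm⟩
  rcases le_total (Finset.univ.sup e) (Finset.univ.sup f) with h | h
  · right
    rw [maxEntry, max_eq_right h] at hpos ⊢
    exact key f hpos
  · left
    rw [maxEntry, max_eq_left h] at hpos ⊢
    exact key e hpos

/-- Otherwise two polynomials in $m$ agree at all naturals, hence everywhere. At $-1/M$, with $M$
the largest entry, this would put $M$ in both $e$ and $f$. -/
theorem exists_prod_choose_ne {u v : ℕ} {e : Fin u → ℕ} {f : Fin v → ℕ}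
    (hdisj : Disjoint (Set.range e) (Set.range f)) (hpos : 0 < maxEntry e f)
    {q : Fin u → ℕ} {r : Fin v → ℕ} (hq : ∀ i, e i = maxEntry e f → 0 < q i)
    (hr : ∀ j, f j = maxEntry e f → 0 < r j) :
    ∃ m : ℕ, (∏ i, (((q i + e i * m).choose (e i * m) : ℕ) : ℚ)) /
      (∏ j, (((r j + f j * m).choose (f j * m) : ℕ) : ℚ)) ≠ 1 := by
  by_contra! h
  have hfac : ∀ {w : ℕ} (g : Fin w → ℕ), ∏ j, ((g j)! : ℚ) ≠ 0 := fun g =>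
    Finset.prod_ne_zero_iff.2 fun i _ => by exact_mod_cast Nat.factorial_ne_zero _
  have hpoly : Polynomial.C (∏ j, ((r j)! : ℚ)) * risingPoly e q =
      Polynomial.C (∏ i, ((q i)! : ℚ)) * risingPoly f r := by
    refine Polynomial.eq_of_infinite_eval_eq _ _
      ((Set.infinite_range_of_injective (Nat.cast_injective (R := ℚ))).mono ?_)
    rintro _ ⟨m, rfl⟩
    have h1 := eq_of_div_eq_one (h m)
    simp only [Set.mem_ofPred_eq, Polynomial.eval_mul, Polynomial.eval_C, eval_natCast_risingPoly,
      h1]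
    ring
  have hev := congrArg (Polynomial.eval (-(maxEntry e f : ℚ)⁻¹)) hpoly
  rw [Polynomial.eval_mul, Polynomial.eval_mul, Polynomial.eval_C, Polynomial.eval_C] at hev
  have hiff : (∃ i, e i = maxEntry e f) ↔ ∃ j, f j = maxEntry e f := by
    rw [← eval_risingPoly_eq_zero_iff hpos (le_maxEntry_left e f) hq,
      ← eval_risingPoly_eq_zero_iff hpos (le_maxEntry_right e f) hr,
      ← mul_right_inj' (hfac r), hev, mul_zero, mul_eq_zero_iff_left (hfac q)]
  obtain ⟨i, hi⟩ : ∃ i, e i = maxEntry e f := by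
    rcases exists_maxEntry e f hpos with h | h
    · exact h
    · exact hiff.2 h
  obtain ⟨j, hj⟩ := hiff.1 ⟨i, hi⟩
  exact Set.disjoint_left.1 hdisj ⟨i, rfl⟩ ⟨j, hj.trans hi.symm⟩

end Choose

/-! ### From (i) to (iii). -/

section Converse

variable {u v : ℕ} {e : Fin u → ℕ} {f : Fin v → ℕ}

theorem exists_mem_of_eventually {S : Set Nat.Primes} (hS : S.Infinite) {P : ℕ → Prop}
    (h : ∀ᶠ p in Filter.atTop, P p) : ∃ p ∈ S, P p := by
  have hinf : (((↑) : Nat.Primes → ℕ) '' S).Infinite :=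
    hS.image (Nat.Primes.coe_nat_injective.injOn)
  obtain ⟨_, ⟨p, hp, rfl⟩, hP⟩ :=
    ((Nat.frequently_atTop_iff_infinite.2 hinf).and_eventually h).exists
  exact ⟨p, hp, hP⟩

theorem padicNorm_neg_prime_pow {p : ℕ} [Fact p.Prime] (n : ℕ) :
    padicNorm p ((-p : ℚ) ^ n) = ((p : ℚ) ^ n)⁻¹ := by
  induction n with
  | zero => simp
  | succ n ih =>
    rw [pow_succ, padicNorm.mul, ih, padicNorm.neg, padicNorm.padicNorm_p_of_prime, pow_succ,
      mul_inv]

theorem padicNorm_Q_mul_prime {p : ℕ} [Fact p.Prime] (e : Fin u → ℕ) (f : Fin v → ℕ) (m : ℕ) :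
    padicNorm p (Q e f (m * p)) * (p : ℚ) ^ ((∑ i, e i) * m) =
      padicNorm p (Q e f m) * (p : ℚ) ^ ((∑ j, f j) * m) := by
  obtain ⟨c, hc, h⟩ := Q_mul_prime e f (p := p) m
  have h' := congrArg (padicNorm p) h
  rw [padicNorm.mul, padicNorm.mul, padicNorm.mul, hc.norm_eq_one, padicNorm_neg_prime_pow,
    padicNorm_neg_prime_pow] at h'
  have hp0 : (p : ℚ) ≠ 0 := by exact_mod_cast (Fact.out : p.Prime).ne_zero
  field_simp at h'
  linarith

/-- One prime at which $\mathcal Q(1)$ is a unit suffices. If $|e|<|f|$, then $\mathcal Q(p)$ is not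
$p$-integral; if $|e|>|f|$, then $p\mid\mathcal Q(p^k)$, although $\mathcal Q(p^k)\equiv\mathcal
Q(1)$. -/
theorem sum_eq_of_congr {S : Set Nat.Primes} (hS : S.Infinite)
    (hint : ∀ p ∈ S, ∀ n, IsPIntegral p (Q e f n)) {k : ℕ} (hk : 0 < k)
    (h : ∀ p ∈ S, ∀ b < (p : ℕ) ^ k, ∀ m,
      CongrModP p (Q e f (b + m * (p : ℕ) ^ k)) (Q e f b * Q e f m)) :
    ∑ i, e i = ∑ j, f j := by
  obtain ⟨p, hpS, hp1⟩ :=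
    exists_mem_of_eventually hS (eventually_one_le_padicNorm (Q_ne_zero e f 1))
  have := Fact.mk p.2
  have hp0 : (0 : ℚ) < (p : ℕ) := by exact_mod_cast p.2.pos
  have hlt : (1 : ℚ) < (p : ℕ) := by exact_mod_cast p.2.one_lt
  have hp1 := hp1 p.2
  have hle := fun n => (isPIntegral_iff _).1 (hint p hpS n)
  rcases lt_trichotomy (∑ i, e i) (∑ j, f j) with hs | hs | hs
  · exfalso
    have h1 := padicNorm_Q_mul_prime (p := p) e f 1
    rw [mul_one, mul_one] at h1
    have h2 := pow_lt_pow_right₀ hlt hs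
    have h3 := mul_le_of_le_one_left (pow_pos hp0 (∑ i, e i)).le (hle (1 * p))
    have h4 := le_mul_of_one_le_left (pow_pos hp0 (∑ j, f j)).le hp1
    linarith
  · exact hs
  · exfalso
    have hdec : ∀ m, 0 < m → padicNorm p (Q e f (m * p)) < padicNorm p (Q e f m) := by
      intro m hm
      have h1 := padicNorm_Q_mul_prime (p := p) e f m
      have h2 := pow_lt_pow_right₀ hlt (Nat.mul_lt_mul_of_pos_right hs hm)
      have hpos : 0 < padicNorm p (Q e f m) :=
        (padicNorm.nonneg _).lt_of_ne' (padicNorm.nonzero (Q_ne_zero e f m))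
      by_contra! hge
      have h3 := mul_le_mul_of_nonneg_right hge (pow_pos hp0 ((∑ i, e i) * m)).le
      have h4 := mul_lt_mul_of_pos_left h2 hpos
      linarith
    have hpow : ∀ n, padicNorm p (Q e f ((p : ℕ) ^ (n + 1))) < padicNorm p (Q e f 1) := by
      intro n
      induction n with
      | zero => simpa using hdec 1 one_pos
      | succ n ih =>
        rw [pow_succ]
        exact (hdec _ (pow_pos p.2.pos _)).trans ih
    have hc := h p hpS 0 (pow_pos p.2.pos k) 1
    rw [zero_add, one_mul, Q_zero, one_mul] at hc
    obtain ⟨n, rfl⟩ := Nat.exists_eq_succ_of_ne_zero hk.ne'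
    exact absurd (hc.norm_lt ((hpow n).trans_le (hle 1))) (not_lt.2 hp1)

theorem lucas_of_congr_pow (hs : ∑ i, e i = ∑ j, f j) {p : ℕ} [hp : Fact p.Prime]
    (hint : ∀ n, IsPIntegral p (Q e f n)) {k : ℕ} (hk : 0 < k)
    (h : ∀ b < p ^ k, ∀ m, CongrModP p (Q e f (b + m * p ^ k)) (Q e f b * Q e f m))
    {a : ℕ} (ha : a < p) (m : ℕ) : CongrModP p (Q e f (a + m * p)) (Q e f a * Q e f m) := by
  have hle := fun n => (isPIntegral_iff _).1 (hint n)
  obtain ⟨n, rfl⟩ := Nat.exists_eq_succ_of_ne_zero hk.ne'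
  -- With $k=n+1$, the digit $b=ap^n$ gives $b+mp^k=(a+mp)p^n$; multiplying the argument by $p^n$
  -- changes $\mathcal Q$ only by a factor $\equiv1$.
  have hc := h (a * p ^ n)
    (by
      rw [Nat.succ_eq_add_one, pow_succ']
      exact Nat.mul_lt_mul_of_pos_right ha (pow_pos hp.out.pos n)) m
  obtain ⟨c, hc1, h1⟩ := Q_mul_prime_pow_of_sum_eq hs (p := p) (a + m * p) n
  obtain ⟨d, hd1, h2⟩ := Q_mul_prime_pow_of_sum_eq hs (p := p) a n
  have hsum : a * p ^ n + m * p ^ n.succ = (a + m * p) * p ^ n := by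
    rw [Nat.succ_eq_add_one, pow_succ]
    ring
  rw [hsum, h1, h2, mul_right_comm] at hc
  refine ((hc1.congrModP_mul (hle _)).symm.trans hc).trans (hd1.congrModP_mul ?_)
  rw [padicNorm.mul]
  exact mul_le_one₀ (hle a) (padicNorm.nonneg _) (hle m)

/-- $\lceil xp\rceil/p$ tends to $x$ from above, and the floor function is right-continuous. -/
theorem eventually_floor_ceil_div (c : ℕ) {x : ℝ} (hx : 0 ≤ x) :
    ∀ᶠ p : ℕ in Filter.atTop, c * ⌈x * p⌉₊ / p = ⌊c * x⌋₊ := by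
  have hlim : Filter.Tendsto (fun p : ℕ => (c : ℝ) * (x + 1 / p)) Filter.atTop
      (nhds (c * (x + 0))) :=
    (tendsto_one_div_atTop_nhds_zero_nat.const_add x).const_mul _
  rw [add_zero] at hlim
  filter_upwards [hlim.eventually_lt_const (Nat.lt_floor_add_one _),
    Filter.eventually_gt_atTop 0] with p hlt hp
  have hp0 : (0 : ℝ) < p := by exact_mod_cast hp
  have h1 : x * p ≤ ⌈x * p⌉₊ := Nat.le_ceil _
  have h2 : (⌈x * p⌉₊ : ℝ) < x * p + 1 := Nat.ceil_lt_add_one (by positivity)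
  rw [← Nat.floor_div_eq_div (K := ℝ), Nat.floor_eq_iff (by positivity)]
  push_cast
  constructor
  · refine (Nat.floor_le (by positivity)).trans ?_
    rw [le_div_iff₀ hp0, mul_assoc]
    gcongr
  · refine lt_of_le_of_lt ?_ hlt
    rw [div_le_iff₀ hp0, mul_assoc, add_mul, one_div_mul_cancel hp0.ne']
    gcongr

theorem eventually_ceil_lt {x : ℝ} (hx : 0 ≤ x) (hx1 : x < 1) :
    ∀ᶠ p : ℕ in Filter.atTop, ⌈x * p⌉₊ < p := by
  filter_upwards [eventually_floor_ceil_div 1 hx, Filter.eventually_gt_atTop 0] with p h hp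
  rw [one_mul, Nat.cast_one, one_mul, Nat.floor_eq_zero.2 hx1, Nat.div_eq_zero_iff] at h
  omega

theorem one_le_landau_of_lucas (hdisj : Disjoint (Set.range e) (Set.range f))
    (hpos : 0 < maxEntry e f) (hs : ∑ i, e i = ∑ j, f j) {S : Set Nat.Primes} (hS : S.Infinite)
    (h : ∀ p ∈ S, HasLucasProperty p (Q e f)) {x : ℝ} (hx : mInv e f ≤ x) (hx1 : x < 1) :
    1 ≤ landau e f x := by
  by_contra! hΔ
  have hM : (0 : ℝ) < maxEntry e f := by exact_mod_cast hpos
  have hx' : 1 ≤ (maxEntry e f : ℝ) * x := by rwa [mInv, inv_le_iff_one_le_mul₀' hM] at hx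
  have hx0 : 0 ≤ x := (inv_nonneg.2 hM.le).trans hx
  have hfl : ∀ c : ℕ, c = maxEntry e f → 0 < ⌊c * x⌋₊ := by
    rintro _ rfl
    exact Nat.floor_pos.2 hx'
  -- The floors at $x$ do not involve $p$, so $m$ can be fixed before $p$ is chosen.
  obtain ⟨m, hm⟩ := exists_prod_choose_ne hdisj hpos (q := fun i => ⌊e i * x⌋₊)
    (r := fun j => ⌊f j * x⌋₊) (fun i hi => hfl _ hi) (fun j hj => hfl _ hj)
  obtain ⟨p, hpS, ⟨⟨⟨⟨hE, hF⟩, hlt⟩, hMp⟩, hQm⟩, hR⟩ := exists_mem_of_eventually hS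
    ((((((Filter.eventually_all.2 fun i => eventually_floor_ceil_div (e i) hx0).and
      (Filter.eventually_all.2 fun j => eventually_floor_ceil_div (f j) hx0)).and
      (eventually_ceil_lt hx0 hx1)).and (Filter.eventually_ge_atTop (maxEntry e f))).and
      (eventually_one_le_padicNorm (Q_ne_zero e f m))).and
      (eventually_one_le_padicNorm (sub_ne_zero.2 hm)))
  have := Fact.mk p.2
  obtain ⟨hint, hluc⟩ := h p hpS
  have hle := fun n => (isPIntegral_iff _).1 (hint n)
  set a := ⌈x * (p : ℕ)⌉₊ with ha
  have hland : landau e f ((a : ℝ) / (p : ℕ)) = landau e f x := by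
    rw [landau_div]
    simp only [hE, hF, landau]
    simp only [Int.natCast_floor_eq_floor (mul_nonneg (Nat.cast_nonneg _) hx0)]
  have hQa : padicNorm p (Q e f a) = 1 := by
    refine le_antisymm (hle a) ?_
    rw [padicNorm_Q_of_lt hlt hMp, hland]
    exact one_le_zpow₀ (by exact_mod_cast p.2.one_lt.le) (by omega)
  have hQm' : padicNorm p (Q e f m) = 1 := le_antisymm (hle m) (hQm p.2)
  obtain ⟨c, hc, hQ⟩ := Q_add_mul_prime_of_sum_eq hs (p := p) a m
  have hcong := hluc a hlt m
  rw [hQ] at hcong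
  simp only [hE, hF] at hcong
  rw [mul_assoc] at hcong
  -- Cancelling the unit $\mathcal Q(a)\mathcal Q(m)$, then $c$, leaves the binomial quotient
  -- $\equiv1 \bmod p$, which `hR` excludes.
  have hone := (oneUnit_of_congrModP (by rw [padicNorm.mul, hQa, hQm', one_mul]) hcong).mul hc.inv
  rw [mul_inv_cancel_right₀ hc.ne_zero] at hone
  exact absurd hone (not_lt.2 (hR p.2))

end Converse

end FactorialRatio

theorem proposition8p3 (u v : ℕ) (e : Fin u → ℕ) (f : Fin v → ℕ)
    (hdisj : Disjoint (Set.range e) (Set.range f))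
    (hpos : 0 < FactorialRatio.maxEntry e f) :
    List.TFAE [
      ∃ S : Set Nat.Primes, S.Infinite ∧
        FactorialRatio.genSeries e f ∈ FactorialRatio.FrakL S,
      (∀ n : ℕ, ∃ z : ℤ, FactorialRatio.Q e f n = z) ∧
        ∀ p : ℕ, p.Prime → FactorialRatio.HasLucasProperty p (FactorialRatio.Q e f),
      (∑ i, e i = ∑ j, f j) ∧
        ∀ x : ℝ, FactorialRatio.mInv e f ≤ x → x < 1 →
          1 ≤ FactorialRatio.landau e f x] := by
  open FactorialRatio in
  tfae_have 1 → 3 := by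
    rintro ⟨S, hS, hmem⟩
    obtain ⟨hint, k, hk, hcong⟩ := congr_of_mem_FrakL (Q_zero e f) hmem
    have hs := sum_eq_of_congr hS hint hk hcong
    refine ⟨hs, fun x hx hx1 => one_le_landau_of_lucas hdisj hpos hs hS (fun p hp => ?_) hx hx1⟩
    have := Fact.mk p.2
    exact ⟨hint p hp, fun a ha m => lucas_of_congr_pow hs (hint p hp) hk (hcong p hp) ha m⟩
  tfae_have 3 → 2 := by
    rintro ⟨hs, h⟩
    exact ⟨exists_int_Q (landau_nonneg hpos hs h),
      fun p hp => hasLucasProperty_of_landau hpos hs h hp⟩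
  tfae_have 2 → 1 := by
    rintro ⟨-, h⟩
    have : Infinite Nat.Primes := Nat.Primes.infinite
    exact ⟨Set.univ, Set.infinite_univ, mk_mem_FrakL (Q_zero e f) fun p _ => h p p.2⟩
  tfae_finish
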